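/- Let $\mathfrak o$ be a compact discrete valuation ring (equivalently, a complete discrete valuation ring with finite residue field) with maximal ideal $\wp$, uniformizer $\pi$ and residue field of cardinality $q$ and characteristic $2$. Put $\mathbf R_{\mathfrak o}=4e$ if $\mathrm{Char}(\mathfrak o)=0$ and $2\mathfrak o=\wp^e$, and $\mathbf R_{\mathfrak o}=2$ if $\mathrm{Char}(\mathfrak o)=2$. Let $r\ge \mathbf R_{\mathfrak o}$, $\ell=\lceil r/2\rceil$, $\ell'=\lfloor r/2\rfloor$, and write $\mathfrak o_k=\mathfrak o/\wp^k$. Fix a homomorphism $\psi:(\mathfrak o_r,+)\to\mathbb C^\times$ with $\psi(\pi^{r-1})\ne 1$. Let $M^\ell$ and $K^\ell$ be the kernels of the reduction maps $\mathrm{GL}_2(\mathfrak o_r)\to\mathrm{GL}_2(\mathfrak o_\ell)$ and $\mathrm{SL}_2(\mathfrak o_r)\to\mathrm{SL}_2(\mathfrak o_\ell)$. Let $A\in M_2(\mathfrak o_{\ell'})$ be cyclic, i.e. $v,Av$ generate $\mathfrak o_{\ell'}^{2}$ for some vector $v$, and let $\tilde A\in M_2(\mathfrak o_r)$ be any lift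 of $A$. Let $\psi_{[A]}:K^\ell\to\mathbb C^\times$ be the homomorphism $I+\pi^\ell B\mapsto\psi(\pi^\ell\,\mathrm{tr}(\tilde A B))$ (it depends only on $A$), and put $C_S^\ell(\tilde A)=\big(C_{\mathrm{GL}_2(\mathfrak o_r)}(\tilde A)\,M^\ell\big)\cap\mathrm{SL}_2(\mathfrak o_r)$. If $\tilde A=\begin{pmatrix}0&\tilde a^{-1}\tilde\alpha\\ \tilde a&\tilde\beta\end{pmatrix}$ with $\tilde a\in\mathfrak o_r^\times$, put $$\mathrm H_{\tilde A}^\ell=\Big\{\begin{pmatrix}1&\tilde a^{-1}x\\0&1\end{pmatrix}\ :\ x\in\mathfrak o_r,\ 2x\equiv 0 \text{ and } x(x+\tilde\beta)\equiv0 \bmod \wp^\ell\Big\}.$$ In general $\tilde A$ is cyclic, hence $g\tilde Ag^{-1}$ has this form for some $g\in\mathrm{SL}_2(\mathfrak o_r)$, and we put $\mathrm H^\ell_{\tilde A}=g^{-1}\,\mathrm H^\ell_{g\tilde Ag^{-1}}\,g$ for any such $g$. For every homomorphism $\chi:C_S^\ell(\tilde A)\to\mathbb C^\times$ extending $\psi_{[A]}$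 let $H_{\tilde A}(\chi)=\{h\in C_S^\ell(\tilde A)\,\mathrm H_{\tilde A}^\ell : \chi^h=\chi\}$, where $\chi^h(x)=\chi(hxh^{-1})$. Then, for every cyclic $A$, every lift $\tilde A$, every such choice of $g$ and every such $\chi$, $$\frac{|H_{\tilde A}(\chi)|}{|C_S^\ell(\tilde A)|}\le q^3 .$$ -/

import Mathlib

namespace SLTwo

open IsLocalRing Matrix

section Rings

variable (𝔬 : Type*) [CommRing 𝔬] [IsLocalRing 𝔬]

/-- The finite quotient `𝔬_k = 𝔬 / ℘ ^ k`. -/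
abbrev Quo (k : ℕ) : Type _ := 𝔬 ⧸ (maximalIdeal 𝔬 ^ k)

/-- The natural surjection `𝔬_r → 𝔬_i` for `i ≤ r`. -/
def red {r i : ℕ} (h : i ≤ r) : Quo 𝔬 r →+* Quo 𝔬 i :=
  Ideal.Quotient.factorPow (maximalIdeal 𝔬) h

/-- The ramification index `e` of a ring `𝔬` of characteristic zero with residue characteristic
two, given by `2 𝔬 = ℘ ^ e`. -/
noncomputable def ramIndex : ℕ :=
  sInf {e : ℕ | Ideal.span {(2 : 𝔬)} = maximalIdeal 𝔬 ^ e}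

/-- The bound `R_𝔬`: it is `4 e` in characteristic zero, and `2` in characteristic two. -/
noncomputable def levelBound : ℕ :=
  if ringChar 𝔬 = 0 then 4 * ramIndex 𝔬 else 2

end Rings

/-- `ℓ = ⌈r / 2⌉`. -/
abbrev ell (r : ℕ) : ℕ := (r + 1) / 2

/-- `ℓ' = ⌊r / 2⌋`. -/
abbrev ell' (r : ℕ) : ℕ := r / 2

theorem ell_le (r : ℕ) : ell r ≤ r := by unfold ell; omega

theorem ell'_le (r : ℕ) : ell' r ≤ r := by unfold ell'; omega

/-- A `2 × 2` matrix `A` is cyclic if `v` and `A v` generate the free module `R ^ 2` for some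
vector `v`. -/
def IsCyclicMat {R : Type*} [CommRing R] (A : Matrix (Fin 2) (Fin 2) R) : Prop :=
  ∃ v : Fin 2 → R, Submodule.span R {v, A *ᵥ v} = ⊤

/-- The matrix with rows `(0, a⁻¹ α)` and `(a, β)`. -/
def companionForm {R : Type*} [CommRing R] (a : Rˣ) (α β : R) : Matrix (Fin 2) (Fin 2) R :=
  !![0, (↑a⁻¹ : R) * α; (a : R), β]

/-- A presentation of `A` as an `SL₂`-conjugate of a matrix `companionForm a α β`. -/
structure NormalForm {R : Type*} [CommRing R] (A : Matrix (Fin 2) (Fin 2) R) where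
  g : SpecialLinearGroup (Fin 2) R
  a : Rˣ
  α : R
  β : R
  conj_eq : (g : Matrix (Fin 2) (Fin 2) R) * A * ((g⁻¹ : SpecialLinearGroup (Fin 2) R) :
    Matrix (Fin 2) (Fin 2) R) = companionForm a α β

/-- The matrix with rows `(1, a⁻¹ x)` and `(0, 1)`, as an element of `SL₂`. -/
def unip {R : Type*} [CommRing R] (a : Rˣ) (x : R) : SpecialLinearGroup (Fin 2) R :=
  ⟨!![1, (↑a⁻¹ : R) * x; 0, 1], by simp⟩

section Groups

variable {𝔬 : Type*} [CommRing 𝔬] [IsLocalRing 𝔬]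

/-- `M ^ i`, the `i`-th congruence subgroup of `GL₂(𝔬_r)`. -/
def congGL {r i : ℕ} (h : i ≤ r) : Subgroup (GL (Fin 2) (Quo 𝔬 r)) :=
  (GeneralLinearGroup.map (n := Fin 2) (red 𝔬 h)).ker

/-- `K ^ i`, the `i`-th congruence subgroup of `SL₂(𝔬_r)`. -/
def congSL {r i : ℕ} (h : i ≤ r) : Subgroup (SpecialLinearGroup (Fin 2) (Quo 𝔬 r)) :=
  (SpecialLinearGroup.map (n := Fin 2) (red 𝔬 h)).ker

/-- The centralizer of the matrix `A` in `GL₂(R)`. -/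
def centGL {R : Type*} [CommRing R] (A : Matrix (Fin 2) (Fin 2) R) :
    Subgroup (GL (Fin 2) R) where
  carrier := {g | (g : Matrix (Fin 2) (Fin 2) R) * A = A * (g : Matrix (Fin 2) (Fin 2) R)}
  one_mem' := by simp
  mul_mem' := by
    intro g h hg hh
    simp only [Set.mem_ofPred_eq, Units.val_mul] at *
    rw [mul_assoc, hh, ← mul_assoc, hg, mul_assoc]
  inv_mem' := by
    intro g hg
    simp only [Set.mem_ofPred_eq] at *
    rw [Units.inv_mul_eq_iff_eq_mul, ← mul_assoc, hg, mul_assoc, Units.mul_inv, mul_one]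

/-- `C_G^ℓ(Ã) = C_{GL₂(𝔬_r)}(Ã) M ^ ℓ`; since `M ^ ℓ` is normal, the join is the product. -/
def cG {r : ℕ} (At : Matrix (Fin 2) (Fin 2) (Quo 𝔬 r)) : Subgroup (GL (Fin 2) (Quo 𝔬 r)) :=
  centGL At ⊔ congGL (ell_le r)

/-- `C_S^ℓ(Ã) = C_G^ℓ(Ã) ∩ SL₂(𝔬_r)`. -/
def cS {r : ℕ} (At : Matrix (Fin 2) (Fin 2) (Quo 𝔬 r)) :
    Subgroup (SpecialLinearGroup (Fin 2) (Quo 𝔬 r)) :=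
  (cG At).comap SpecialLinearGroup.toGL

theorem congSL_le_cS {r : ℕ} (At : Matrix (Fin 2) (Fin 2) (Quo 𝔬 r)) :
    congSL (ell_le r) ≤ cS At := by
  intro k hk
  refine Subgroup.mem_sup_right (?_ : SpecialLinearGroup.toGL k ∈ congGL (ell_le r))
  have hk' : SpecialLinearGroup.map (n := Fin 2) (red 𝔬 (ell_le r)) k = 1 := hk
  change GeneralLinearGroup.map (n := Fin 2) (red 𝔬 (ell_le r)) (SpecialLinearGroup.toGL k) = 1
  ext i j
  have := congrArg (fun m : SpecialLinearGroup (Fin 2) (Quo 𝔬 (ell r)) => m i j) hk'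
  simpa using this

/-- The additive group `h_Ã^ℓ`, which depends on `β̃` only: all `x` in `𝔬_r` with
`2 x = 0` and `x (x + β̃) = 0` modulo `℘ ^ ℓ`. -/
def hAdd {r : ℕ} (β : Quo 𝔬 r) : Set (Quo 𝔬 r) :=
  {x | red 𝔬 (ell_le r) (2 * x) = 0 ∧ red 𝔬 (ell_le r) (x * (x + β)) = 0}

/-- `H_Ã^ℓ`: for `Ã = companionForm a α β` (so `N.g = 1`), the matrices `unip a x` with `x` in
`h_Ã^ℓ`; for an `SL₂`-conjugate of such a matrix, the corresponding conjugate. -/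
def hGrp {r : ℕ} {At : Matrix (Fin 2) (Fin 2) (Quo 𝔬 r)} (N : NormalForm At) :
    Set (SpecialLinearGroup (Fin 2) (Quo 𝔬 r)) :=
  {h | ∃ x ∈ hAdd N.β, h = N.g⁻¹ * unip N.a x * N.g}

/-- The stabilizer `H_Ã(χ)` of a one-dimensional representation `χ` of `C_S^ℓ(Ã)`: all `g` in the
product `C_S^ℓ(Ã) H_Ã^ℓ` with `χ ^ g = χ`. -/
def stab {r : ℕ} {At : Matrix (Fin 2) (Fin 2) (Quo 𝔬 r)} (N : NormalForm At)
    (χ : cS At →* ℂˣ) : Set (SpecialLinearGroup (Fin 2) (Quo 𝔬 r)) :=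
  {g | (∃ c ∈ cS At, ∃ h ∈ hGrp N, g = c * h) ∧
    ∀ x : cS At, ∃ hx : g * (x : SpecialLinearGroup (Fin 2) (Quo 𝔬 r)) * g⁻¹ ∈ cS At,
      χ ⟨g * x * g⁻¹, hx⟩ = χ x}

end Groups

section Facts

variable {R : Type*} [CommRing R]

theorem isCyclicMat_iff (A : Matrix (Fin 2) (Fin 2) R) :
    IsCyclicMat A ↔ ∃ v : Fin 2 → R, IsUnit (v 0 * (A *ᵥ v) 1 - v 1 * (A *ᵥ v) 0) := by
  constructor
  · rintro ⟨v, hv⟩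
    refine ⟨v, ?_⟩
    have h0 : (![1, 0] : Fin 2 → R) ∈ Submodule.span R {v, A *ᵥ v} := hv ▸ Submodule.mem_top
    have h1 : (![0, 1] : Fin 2 → R) ∈ Submodule.span R {v, A *ᵥ v} := hv ▸ Submodule.mem_top
    obtain ⟨p, q, hpq⟩ := Submodule.mem_span_pair.1 h0
    obtain ⟨s, t, hst⟩ := Submodule.mem_span_pair.1 h1
    have e1 := congrFun hpq 0
    have e2 := congrFun hpq 1
    have e3 := congrFun hst 0
    have e4 := congrFun hst 1
    simp only [Pi.add_apply, Pi.smul_apply, smul_eq_mul, cons_val_zero, cons_val_one] at e1 e2 e3 e4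
    refine IsUnit.of_mul_eq_one (p * t - q * s) ?_
    linear_combination (s * v 1 + t * (A *ᵥ v) 1) * e1 + e4 - (p * v 1 + q * (A *ᵥ v) 1) * e3
  · rintro ⟨v, hv⟩
    refine ⟨v, ?_⟩
    obtain ⟨d, hd⟩ := hv.exists_right_inv
    rw [eq_top_iff]
    intro w _
    rw [Submodule.mem_span_pair]
    refine ⟨d * (w 0 * (A *ᵥ v) 1 - w 1 * (A *ᵥ v) 0), d * (v 0 * w 1 - v 1 * w 0), ?_⟩
    ext i
    fin_cases i
    · simp only [Fin.zero_eta, Pi.add_apply, Pi.smul_apply, smul_eq_mul]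
      linear_combination (w 0) * hd
    · simp only [Fin.mk_one, Pi.add_apply, Pi.smul_apply, smul_eq_mul]
      linear_combination (w 1) * hd

/-- Every cyclic matrix is `SL₂`-conjugate to some `companionForm a α β`. -/
theorem IsCyclicMat.nonempty_normalForm {A : Matrix (Fin 2) (Fin 2) R} (hA : IsCyclicMat A) :
    Nonempty (NormalForm A) := by
  obtain ⟨v, hv⟩ := (isCyclicMat_iff A).1 hA
  obtain ⟨a, ha⟩ := hv
  have haa : (a : R) * (↑a⁻¹ : R) = 1 := Units.mul_inv a
  have w0 : (A *ᵥ v) 0 = A 0 0 * v 0 + A 0 1 * v 1 := by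
    simp [mulVec, dotProduct, Fin.sum_univ_two]
  have w1 : (A *ᵥ v) 1 = A 1 0 * v 0 + A 1 1 * v 1 := by
    simp [mulVec, dotProduct, Fin.sum_univ_two]
  rw [w0, w1] at ha
  let P : SpecialLinearGroup (Fin 2) R :=
    ⟨!![v 0, (↑a⁻¹ : R) * (A 0 0 * v 0 + A 0 1 * v 1);
        v 1, (↑a⁻¹ : R) * (A 1 0 * v 0 + A 1 1 * v 1)], by
      rw [det_fin_two_of]
      linear_combination haa - (↑a⁻¹ : R) * ha⟩
  refine ⟨⟨P⁻¹, a, -A.det, A.trace, ?_⟩⟩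
  have key : A * (P : Matrix (Fin 2) (Fin 2) R) =
      (P : Matrix (Fin 2) (Fin 2) R) * companionForm a (-A.det) A.trace := by
    ext i j
    fin_cases i <;> fin_cases j <;>
      simp only [P, companionForm, mul_apply, Fin.sum_univ_two, det_fin_two, trace_fin_two,
        of_apply, cons_val', cons_val_zero, cons_val_one, Fin.zero_eta, Fin.mk_one,
        cons_val_fin_one]
    · linear_combination (-(A 0 0 * v 0 + A 0 1 * v 1)) * haa
    · ring
    · linear_combination (-(A 1 0 * v 0 + A 1 1 * v 1)) * haa
    · ring
  have hP : ((P⁻¹ : SpecialLinearGroup (Fin 2) R) : Matrix (Fin 2) (Fin 2) R) *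
      (P : Matrix (Fin 2) (Fin 2) R) = 1 := congrArg Subtype.val (inv_mul_cancel P)
  rw [inv_inv, mul_assoc, key, ← mul_assoc, hP, one_mul]

end Facts

section Characters

variable {𝔬 : Type*} [CommRing 𝔬] [IsLocalRing 𝔬]

theorem red_surjective {r i : ℕ} (h : i ≤ r) : Function.Surjective (red 𝔬 h) :=
  Ideal.Quotient.factor_surjective (Ideal.pow_le_pow_right h)

/-- Every lift of a cyclic matrix is cyclic. -/
theorem IsCyclicMat.of_lift {r i : ℕ} (h : i ≤ r) (hi : 1 ≤ i) {A : Matrix (Fin 2) (Fin 2) (Quo 𝔬 i)}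
    (hA : IsCyclicMat A) {At : Matrix (Fin 2) (Fin 2) (Quo 𝔬 r)} (hAt : At.map (red 𝔬 h) = A) :
    IsCyclicMat At := by
  obtain ⟨v, hv⟩ := (isCyclicMat_iff A).1 hA
  choose f hf using red_surjective (𝔬 := 𝔬) h
  refine (isCyclicMat_iff At).2 ⟨fun j => f (v j), ?_⟩
  have hle : maximalIdeal 𝔬 ^ i ≠ ⊤ := fun ht => (maximalIdeal.isMaximal 𝔬).ne_top
    (top_le_iff.1 (ht ▸ Ideal.pow_le_self (by omega)))
  have hler : maximalIdeal 𝔬 ^ r ≠ ⊤ := fun ht => hle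
    (top_le_iff.1 (ht ▸ Ideal.pow_le_pow_right h))
  have : Nontrivial (Quo 𝔬 i) := Ideal.Quotient.nontrivial_iff.2 hle
  have : Nontrivial (Quo 𝔬 r) := Ideal.Quotient.nontrivial_iff.2 hler
  have : IsLocalRing (Quo 𝔬 r) :=
    IsLocalRing.of_surjective' (Ideal.Quotient.mk _) Ideal.Quotient.mk_surjective
  have : IsLocalHom (red 𝔬 h) := (red_surjective h).isLocalHom
  refine isUnit_of_map_unit (red 𝔬 h) _ ?_
  convert hv using 1
  subst hAt
  simp [mulVec, dotProduct, Fin.sum_univ_two, hf]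

theorem red_eq_zero_iff {r i : ℕ} (h : i ≤ r) (x : 𝔬) :
    red 𝔬 h (Ideal.Quotient.mk _ x) = 0 ↔ x ∈ maximalIdeal 𝔬 ^ i := by
  change Ideal.Quotient.mk _ x = 0 ↔ _
  exact Ideal.Quotient.eq_zero_iff_mem

theorem mul_eq_zero_of_red {r i j : ℕ} (hi : i ≤ r) (hj : j ≤ r) (hij : r ≤ i + j)
    {x y : Quo 𝔬 r} (hx : red 𝔬 hi x = 0) (hy : red 𝔬 hj y = 0) : x * y = 0 := by
  obtain ⟨x, rfl⟩ := Ideal.Quotient.mk_surjective x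
  obtain ⟨y, rfl⟩ := Ideal.Quotient.mk_surjective y
  rw [red_eq_zero_iff] at hx hy
  rw [← map_mul, Ideal.Quotient.eq_zero_iff_mem]
  exact Ideal.pow_le_pow_right hij (pow_add (maximalIdeal 𝔬) i j ▸ Ideal.mul_mem_mul hx hy)

theorem matrix_mul_eq_zero {r i j : ℕ} (hi : i ≤ r) (hj : j ≤ r) (hij : r ≤ i + j)
    {X Y : Matrix (Fin 2) (Fin 2) (Quo 𝔬 r)} (hX : X.map (red 𝔬 hi) = 0)
    (hY : Y.map (red 𝔬 hj) = 0) : X * Y = 0 := by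
  ext s t
  rw [mul_apply, Matrix.zero_apply]
  refine Finset.sum_eq_zero fun k _ => mul_eq_zero_of_red hi hj hij ?_ ?_
  · exact congrFun (congrFun hX s) k
  · exact congrFun (congrFun hY k) t

theorem congSL_sub_one {r i : ℕ} (h : i ≤ r) {k : SpecialLinearGroup (Fin 2) (Quo 𝔬 r)}
    (hk : k ∈ congSL h) :
    ((k : Matrix (Fin 2) (Fin 2) (Quo 𝔬 r)) - 1).map (red 𝔬 h) = 0 := by
  have hk' : SpecialLinearGroup.map (n := Fin 2) (red 𝔬 h) k = 1 := hk
  have hm : (red 𝔬 h).mapMatrix (k : Matrix (Fin 2) (Fin 2) (Quo 𝔬 r)) = 1 :=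
    congrArg Subtype.val hk'
  change (red 𝔬 h).mapMatrix _ = 0
  rw [map_sub, hm, map_one, sub_self]

/-- The restriction to `K ^ ℓ` of the one-dimensional representation `ψ_Â` of `M ^ ℓ`, written
without the uniformizer: `X ↦ ψ (trace (Â (X - 1)))`. -/
def psiLift {r : ℕ} (ψ : AddChar (Quo 𝔬 r) ℂˣ) (Ah : Matrix (Fin 2) (Fin 2) (Quo 𝔬 r)) :
    (congSL (𝔬 := 𝔬) (ell_le r)) →* ℂˣ where
  toFun k := ψ (trace (Ah * ((k : SpecialLinearGroup (Fin 2) (Quo 𝔬 r)).1 - 1)))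
  map_one' := by simp
  map_mul' := by
    intro k m
    rw [← AddChar.map_add_eq_mul, ← trace_add, ← mul_add]
    congr 3
    have := matrix_mul_eq_zero (ell_le r) (ell_le r) (by unfold ell; omega)
      (congSL_sub_one _ k.2) (congSL_sub_one _ m.2)
    rw [sub_mul, mul_sub, mul_sub, one_mul, one_mul, mul_one] at this
    rw [← sub_eq_zero, ← this]
    change (k.1.1 * m.1.1) - 1 - _ = _
    abel

/-- The one-dimensional representation `ψ_[A]` of `K ^ ℓ` for `A` in `M₂(𝔬_ℓ')`, defined by means
of an arbitrary lift of `A`; see `psi_apply`. -/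
noncomputable def psi {r : ℕ} (ψ : AddChar (Quo 𝔬 r) ℂˣ)
    (A : Matrix (Fin 2) (Fin 2) (Quo 𝔬 (ell' r))) :
    (congSL (𝔬 := 𝔬) (ell_le r)) →* ℂˣ :=
  psiLift ψ (A.map (Function.surjInv (red_surjective (ell'_le r))))

theorem psi_eq_psiLift {r : ℕ} (ψ : AddChar (Quo 𝔬 r) ℂˣ)
    (A : Matrix (Fin 2) (Fin 2) (Quo 𝔬 (ell' r))) (Ah : Matrix (Fin 2) (Fin 2) (Quo 𝔬 r))
    (hA : Ah.map (red 𝔬 (ell'_le r)) = A) : psi ψ A = psiLift ψ Ah := by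
  ext1 k
  change ψ _ = ψ _
  congr 2
  rw [← sub_eq_zero, ← sub_mul]
  refine matrix_mul_eq_zero (ell'_le r) (ell_le r) (by unfold ell ell'; omega) ?_
    (congSL_sub_one _ k.2)
  subst hA
  ext i j
  simp [Function.surjInv_eq]

/-- The defining formula `ψ_[A] (I + π ^ ℓ B) = ψ (π ^ ℓ trace (Â B))`, for every lift `Â`. -/
theorem psi_apply {r : ℕ} (ψ : AddChar (Quo 𝔬 r) ℂˣ)
    (A : Matrix (Fin 2) (Fin 2) (Quo 𝔬 (ell' r))) (Ah : Matrix (Fin 2) (Fin 2) (Quo 𝔬 r))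
    (hA : Ah.map (red 𝔬 (ell'_le r)) = A) (ϖ : 𝔬) (B : Matrix (Fin 2) (Fin 2) (Quo 𝔬 r))
    (k : congSL (𝔬 := 𝔬) (ell_le r))
    (hk : (k : SpecialLinearGroup (Fin 2) (Quo 𝔬 r)).1 =
      1 + (Ideal.Quotient.mk _ (ϖ ^ ell r) : Quo 𝔬 r) • B) :
    psi ψ A k = ψ ((Ideal.Quotient.mk _ (ϖ ^ ell r) : Quo 𝔬 r) * trace (Ah * B)) := by
  rw [psi_eq_psiLift ψ A Ah hA]
  change ψ _ = ψ _
  rw [hk, add_sub_cancel_left, Matrix.mul_smul, trace_smul, smul_eq_mul]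

/-- The set `𝓔_Ã` of all extensions of `ψ_[A]` to `C_S^ℓ(Ã)`. -/
def extensions {r : ℕ} (ψ : AddChar (Quo 𝔬 r) ℂˣ)
    (A : Matrix (Fin 2) (Fin 2) (Quo 𝔬 (ell' r)))
    (At : Matrix (Fin 2) (Fin 2) (Quo 𝔬 r)) : Set (cS At →* ℂˣ) :=
  {χ | ∀ k : congSL (𝔬 := 𝔬) (ell_le r),
    χ (Subgroup.inclusion (congSL_le_cS At) k) = psi ψ A k}

end Characters

end SLTwo

namespace SLTwo

open IsLocalRing Matrix

/-! ### Commutators of unipotents with elements of the centralizer -/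

section Commutators

variable {R : Type*} [CommRing R]

/-! Since `χ` is a class function on `C_S^ℓ`, an element `c h` of the product fixes `χ` exactly when
`h` does. Writing `h` as the conjugate of `unip a x`, and noting that `x ≡ 0` mod `℘^ℓ` puts `h` in
`K^ℓ ⊆ C_S^ℓ`, the index is at most the size of an additive subgroup `T` of `𝔬_ℓ`: the residues of
all stabilizing `x` (`card_stab_le`). Filtering `T` by powers of the uniformizer bounds it by `q ^
|V|`, where `V` contains the valuations of its nonzero elements (`card_le_pow_card_valuations`). It
remains to find such a `V` with at most three elements.

Let `N(s, t) = det (s + t A)`. If `N(s, t) ≡ 1` and `t x ≡ 0` mod `℘^ℓ`, the commutator of `unip a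
x` with the correction of `s + t A` to determinant one lies in `K^ℓ`. There `χ` is `ψ_[A]`, and
invariance of `χ` becomes `ψ (x (N(s, t) - 1) - s t x²) = 1` (`apply_eq_one_of_stabilizes`). A
valuation `m` of `x` is excluded by choosing `s, t` so that the argument is `ϖ^(r-1)` mod `ϖ^r`.

In characteristic zero, scalars (`t = 0`) leave only `m = ℓ - 1`. In characteristic two, scalars
force `m ≡ r` mod 2 for `m < ℓ'`. Writing `α = γ² + ϖ δ²` and taking `s = 1 + γ t`, the argument
becomes `s t x (β - x) - ϖ δ² t² x`. With `b`, `d` the valuations of `β`, `δ`, these two terms must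
balance when `m ≠ b`, giving `m + 2 min m b = r + 2 d`, which has at most one solution. So `V`
consists of `ℓ - 1`, `b` and that solution. -/

theorem unip_add (a : Rˣ) (x y : R) : unip a (x + y) = unip a x * unip a y := by
  refine Subtype.ext ?_
  change !![1, (↑a⁻¹ : R) * (x + y); 0, 1] =
    !![1, (↑a⁻¹ : R) * x; 0, 1] * !![1, (↑a⁻¹ : R) * y; 0, 1]
  simp [mul_add, add_comm]

theorem unip_zero (a : Rˣ) : unip a (0 : R) = 1 := by
  ext i j
  fin_cases i <;> fin_cases j <;> simp [unip]

theorem inv_unip (a : Rˣ) (x : R) : (unip a x)⁻¹ = unip a (-x) := by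
  rw [inv_eq_iff_mul_eq_one, ← unip_add, add_neg_cancel, unip_zero]

/-- The norm `det (s + t A)` for `A = companionForm a α β`. -/
def compNorm (α β s t : R) : R := s ^ 2 + s * t * β - α * t ^ 2

/-- The matrix `s + t A` for `A = companionForm a α β`. -/
def compElt (a : Rˣ) (α β s t : R) : Matrix (Fin 2) (Fin 2) R :=
  !![s, t * ((↑a⁻¹ : R) * α); t * a, s + t * β]

theorem det_compElt (a : Rˣ) (α β s t : R) : (compElt a α β s t).det = compNorm α β s t := by
  have := a.mul_inv
  rw [compElt, det_fin_two_of, compNorm]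
  linear_combination (-(t ^ 2 * α)) * this

theorem compElt_mul_companionForm (a : Rˣ) (α β s t : R) :
    compElt a α β s t * companionForm a α β = companionForm a α β * compElt a α β s t := by
  ext i j
  fin_cases i <;> fin_cases j <;>
    simp [compElt, companionForm, mul_apply, Fin.sum_univ_two] <;> ring

/-- The element `(s + t A) diag (n, 1)` of `SL₂`, where `n` is inverse to the norm of
`s + t A`. -/
def compSL (a : Rˣ) (α β s t n : R) (h : n * compNorm α β s t = 1) :
    SpecialLinearGroup (Fin 2) R :=
  ⟨compElt a α β s t * !![n, 0; 0, 1], by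
    rw [det_mul, det_compElt, det_fin_two_of, mul_one, zero_mul, sub_zero, mul_comm, h]⟩

/-- The commutator of `unip a x` and `compSL a α β s t n`. -/
def commSL (a : Rˣ) (α β s t n : R) (h : n * compNorm α β s t = 1) (x : R) :
    SpecialLinearGroup (Fin 2) R :=
  unip a x * compSL a α β s t n h * (unip a x)⁻¹ * (compSL a α β s t n h)⁻¹

theorem commSL_coe (a : Rˣ) (α β s t n : R) (h : n * compNorm α β s t = 1) (x : R) :
    (commSL a α β s t n h x : Matrix (Fin 2) (Fin 2) R) =
      !![1 + t * x * (n ^ 2 * (s + x * t)), (↑a⁻¹ : R) * (x * (1 - s * n ^ 2 * (s + x * t)));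
        t * x * (a * t * n ^ 2), 1 - t * x * (s * n ^ 2)] := by
  have ha := a.mul_inv
  rw [commSL, inv_unip]
  change !![1, (↑a⁻¹ : R) * x; 0, 1] *
    (!![s, t * ((↑a⁻¹ : R) * α); t * a, s + t * β] * !![n, 0; 0, 1]) *
    !![1, (↑a⁻¹ : R) * (-x); 0, 1] *
    (!![s, t * ((↑a⁻¹ : R) * α); t * a, s + t * β] * !![n, 0; 0, 1]).adjugate = _
  rw [compNorm] at h
  ext i j
  fin_cases i <;> fin_cases j <;> simp [adjugate_fin_two_of]
  · linear_combination h + (t ^ 2 * n ^ 2 * x ^ 2 * (a * (↑a⁻¹ : R) + 1) + t * n ^ 2 * x * s - n * t ^ 2 * α) * ha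
  · linear_combination (↑a⁻¹ : R) * x * h + (↑a⁻¹ : R) * (-n * t ^ 2 * x * α - s * t * n ^ 2 * x ^ 2) * ha
  · linear_combination t ^ 2 * n ^ 2 * x * a * ha
  · linear_combination h - (s * t * n ^ 2 * x + n * t ^ 2 * α) * ha

/-- The hypotheses hold once `t x` and the norm minus one vanish mod `℘^ℓ`, because `2 ℓ ≥ r`. They
linearize the inverse norm and remove every power of `n` next to `t x`. -/
theorem trace_commSL (a : Rˣ) (α β s t n : R) (h : n * compNorm α β s t = 1) (x : R)
    (h0 : t * x * (compNorm α β s t - 1) = 0)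
    (h1 : (compNorm α β s t - 1) * (compNorm α β s t - 1) = 0) :
    trace (companionForm a α β * ((commSL a α β s t n h x).1 - 1)) =
      x * (compNorm α β s t - 1) - s * t * x ^ 2 := by
  have ha := a.mul_inv
  -- `(N - 1)² = 0` means that `2 - N` is the inverse of the norm `N`.
  have hn : n = 2 - compNorm α β s t := by
    linear_combination (2 - compNorm α β s t) * h + n * h1
  have htx : t * x * n = t * x := by rw [hn]; linear_combination -h0
  rw [commSL_coe]
  simp only [companionForm, trace_fin_two, mul_apply, Fin.sum_univ_two, Matrix.sub_apply]
  simp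
  have e : (α * (t * x * (t * n ^ 2)) + x * (1 - s * n ^ 2 * (s + x * t))
      - β * (t * x * (s * n ^ 2))) = x - n ^ 2 * x * compNorm α β s t - s * x * (t * x * n) * n := by
    rw [compNorm]; ring
  rw [htx] at e
  have e2 : s * x * (t * x) * n = s * x * (t * x) := by linear_combination s * x * htx
  rw [e2] at e
  linear_combination e + (α * t ^ 2 * x * n ^ 2) * ha
    - n * x * h - x * hn

/-- Three entries differ from those of the identity by multiples of `t x`. For the upper right one,
`x s² ≡ x N ≡ x` modulo `t x`. -/
theorem map_commSL_eq_one {R' : Type*} [CommRing R'] (ρ : R →+* R') (a : Rˣ) (α β s t n : R)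
    (h : n * compNorm α β s t = 1) (x : R) (h0 : ρ (t * x) = 0) (h1 : ρ (compNorm α β s t) = 1) :
    SpecialLinearGroup.map (n := Fin 2) ρ (commSL a α β s t n h x) = 1 := by
  have hn : ρ n = 1 := by simpa [h1] using congrArg ρ h
  have hx : ρ (x * (1 - s * n ^ 2 * (s + x * t))) = 0 := by
    have h2 : ρ s ^ 2 + ρ s * ρ t * ρ β - ρ α * ρ t ^ 2 = 1 := by
      simpa [compNorm] using h1
    simp only [map_mul, map_sub, map_one, map_add, map_pow, hn] at h0 ⊢
    linear_combination (ρ s * ρ β - ρ α * ρ t - ρ s * ρ x) * h0 - ρ x * h2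
  apply Subtype.ext
  ext i j
  rw [SpecialLinearGroup.map_apply_coe, RingHom.mapMatrix_apply, commSL_coe]
  fin_cases i <;> fin_cases j <;>
    simp only [Fin.zero_eta, Fin.mk_one, map_apply, of_apply, cons_val', cons_val_zero,
      cons_val_one, cons_val_fin_one] <;>
    rw [← sub_eq_zero] <;> simp [-map_mul, map_mul ρ (t * x), map_mul ρ (↑a⁻¹ : R), h0, hx]

end Commutators

/-! ### Invariance of `χ` as a condition on `ψ` -/

section Groups

variable {𝔬 : Type*} [CommRing 𝔬] [IsLocalRing 𝔬]

theorem commute_conj {M : Type*} [Monoid M] {g p x y c : M} (h : g * p = 1)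
    (hx : x = p * y * g) (hc : c * y = y * c) : p * c * g * x = x * (p * c * g) := by
  calc p * c * g * x = p * (c * (g * p) * y) * g := by simp only [hx, mul_assoc]
    _ = p * (y * (g * p) * c) * g := by rw [h, mul_one, mul_one, hc]
    _ = x * (p * c * g) := by simp only [hx, mul_assoc]

/-- The factor `s + t A` centralizes `A`, and `diag (n, 1)` lies in `M^ℓ` because the norm is 1 mod
`℘^ℓ`; conjugation by `g⁻¹` carries this over to `Ã`. -/
theorem compSL_conj_mem_cS {r : ℕ} {At : Matrix (Fin 2) (Fin 2) (Quo 𝔬 r)} (N : NormalForm At)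
    (s t n : Quo 𝔬 r) (h : n * compNorm N.α N.β s t = 1)
    (h1 : red 𝔬 (ell_le r) (compNorm N.α N.β s t) = 1) :
    N.g⁻¹ * compSL N.a N.α N.β s t n h * N.g ∈ cS At := by
  have hn : red 𝔬 (ell_le r) n = 1 := by simpa [h1] using congrArg (red 𝔬 (ell_le r)) h
  let G : GL (Fin 2) (Quo 𝔬 r) := SpecialLinearGroup.toGL N.g
  have hdet : IsUnit (compElt N.a N.α N.β s t).det := by
    rw [det_compElt]
    exact IsUnit.of_mul_eq_one_right _ h
  let C : GL (Fin 2) (Quo 𝔬 r) := GeneralLinearGroup.mk'' _ hdet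
  let E : GL (Fin 2) (Quo 𝔬 r) := GeneralLinearGroup.mk'' !![n, 0; 0, 1] (by
    rw [det_fin_two_of, mul_one, zero_mul, sub_zero]
    exact IsUnit.of_mul_eq_one _ h)
  have hE : E ∈ congGL (𝔬 := 𝔬) (ell_le r) := by
    change GeneralLinearGroup.map (n := Fin 2) (red 𝔬 (ell_le r)) E = 1
    ext i j
    change red 𝔬 (ell_le r) ((!![n, 0; 0, 1] : Matrix (Fin 2) (Fin 2) (Quo 𝔬 r)) i j) =
      (1 : Matrix (Fin 2) (Fin 2) (Quo 𝔬 (ell r))) i j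
    fin_cases i <;> fin_cases j <;> simp [hn]
  have hC : G⁻¹ * C * G ∈ centGL At := by
    have hAt : At = (G⁻¹ : GL (Fin 2) (Quo 𝔬 r)).1 * companionForm N.a N.α N.β * G.1 := by
      have e := N.conj_eq
      change G.1 * At * (G⁻¹ : GL (Fin 2) (Quo 𝔬 r)).1 = _ at e
      rw [← e, ← mul_assoc, ← mul_assoc, Units.inv_mul, one_mul, mul_assoc, Units.inv_mul, mul_one]
    exact commute_conj (Units.mul_inv G) hAt (compElt_mul_companionForm N.a N.α N.β s t)
  have key : SpecialLinearGroup.toGL (N.g⁻¹ * compSL N.a N.α N.β s t n h * N.g) =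
      (G⁻¹ * C * G) * (G⁻¹ * E * G) := by
    have : SpecialLinearGroup.toGL (compSL N.a N.α N.β s t n h) = C * E := by
      ext1
      rfl
    rw [map_mul, map_mul, map_inv, this]
    change G⁻¹ * (C * E) * G = _
    group
  change SpecialLinearGroup.toGL _ ∈ cG At
  rw [key]
  refine Subgroup.mul_mem_sup hC ?_
  have := (MonoidHom.normal_ker _ : (congGL (𝔬 := 𝔬) (ell_le r)).Normal).conj_mem E hE G⁻¹
  rwa [inv_inv] at this

/-- The conjugate by `N.g⁻¹` of `unip N.a x`. -/
def conjUnip {R : Type*} [CommRing R] {At : Matrix (Fin 2) (Fin 2) R}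
    (N : NormalForm At) (x : R) : SpecialLinearGroup (Fin 2) R :=
  N.g⁻¹ * unip N.a x * N.g

theorem trace_mul_conj {R : Type*} [CommRing R] {At : Matrix (Fin 2) (Fin 2) R}
    (N : NormalForm At) (Z : SpecialLinearGroup (Fin 2) R) :
    trace (At * ((N.g⁻¹ * Z * N.g).1 - 1)) =
      trace (companionForm N.a N.α N.β * (Z.1 - 1)) := by
  have hP : (N.g⁻¹).1 * N.g.1 = 1 := congrArg Subtype.val (inv_mul_cancel N.g)
  have e : (N.g⁻¹ * Z * N.g).1 - 1 = (N.g⁻¹).1 * (Z.1 - 1) * N.g.1 := by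
    change (N.g⁻¹).1 * Z.1 * N.g.1 - 1 = _
    rw [mul_sub, sub_mul, mul_one, hP]
  rw [e, ← N.conj_eq, ← mul_assoc, trace_mul_comm]
  simp only [mul_assoc]

/-- Conjugating `X` by the unipotent multiplies it by a commutator in `K^ℓ`, so invariance of `χ` at
`X` says that `ψ_[A]` is 1 on that commutator. The trace formula evaluates it. -/
theorem apply_eq_one_of_stabilizes {r : ℕ} {ψ : AddChar (Quo 𝔬 r) ℂˣ}
    {A : Matrix (Fin 2) (Fin 2) (Quo 𝔬 (ell' r))} {At : Matrix (Fin 2) (Fin 2) (Quo 𝔬 r)}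
    (hAt : At.map (red 𝔬 (ell'_le r)) = A) (N : NormalForm At)
    {χ : cS At →* ℂˣ} (hχ : χ ∈ extensions ψ A At) {x : Quo 𝔬 r}
    (hx : ∀ X : cS At, ∃ hX : conjUnip N x * X * (conjUnip N x)⁻¹ ∈ cS At,
      χ ⟨conjUnip N x * X * (conjUnip N x)⁻¹, hX⟩ = χ X)
    {s t n : Quo 𝔬 r} (h : n * compNorm N.α N.β s t = 1)
    (h0 : red 𝔬 (ell_le r) (t * x) = 0)
    (h1 : red 𝔬 (ell_le r) (compNorm N.α N.β s t) = 1) :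
    ψ (x * (compNorm N.α N.β s t - 1) - s * t * x ^ 2) = 1 := by
  have h2 : red 𝔬 (ell_le r) (compNorm N.α N.β s t - 1) = 0 := by rw [map_sub, h1, map_one, sub_self]
  have hr : r ≤ ell r + ell r := by unfold ell; omega
  rw [← trace_commSL N.a N.α N.β s t n h x (mul_eq_zero_of_red _ _ hr h0 h2)
    (mul_eq_zero_of_red _ _ hr h2 h2), ← trace_mul_conj]
  set Z := commSL N.a N.α N.β s t n h x with hZ
  have hZm : Z ∈ congSL (𝔬 := 𝔬) (ell_le r) :=
    map_commSL_eq_one (red 𝔬 (ell_le r)) N.a N.α N.β s t n h x h0 h1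
  have hZc : N.g⁻¹ * Z * N.g ∈ congSL (𝔬 := 𝔬) (ell_le r) := by
    have := (MonoidHom.normal_ker _ : (congSL (𝔬 := 𝔬) (ell_le r)).Normal).conj_mem Z hZm N.g⁻¹
    rwa [inv_inv] at this
  have e := hχ ⟨_, hZc⟩
  rw [psi_eq_psiLift ψ A At hAt] at e
  change _ = ψ (trace (At * ((N.g⁻¹ * Z * N.g).1 - 1))) at e
  rw [← e]
  obtain ⟨hX, hX'⟩ := hx ⟨_, compSL_conj_mem_cS N s t n h h1⟩
  have key : (⟨_, hX⟩ : cS At) = Subgroup.inclusion (congSL_le_cS At) ⟨_, hZc⟩ *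
      ⟨_, compSL_conj_mem_cS N s t n h h1⟩ := by
    apply Subtype.ext
    change conjUnip N x * (N.g⁻¹ * compSL N.a N.α N.β s t n h * N.g) * (conjUnip N x)⁻¹ =
      N.g⁻¹ * Z * N.g * (N.g⁻¹ * compSL N.a N.α N.β s t n h * N.g)
    rw [hZ, commSL, conjUnip]
    group
  rw [key, map_mul] at hX'
  exact mul_eq_right.1 hX'

end Groups

/-! ### Excluding valuations of `x` by choices of `s` and `t` -/

section Valuations

variable {𝔬 : Type*} [CommRing 𝔬] {ϖ : 𝔬}

theorem isUnit_add_mul_of_irreducible [IsLocalRing 𝔬] (hϖ : Irreducible ϖ) {u : 𝔬} (hu : IsUnit u) (z : 𝔬) :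
    IsUnit (u + ϖ * z) := by
  by_contra h
  have h1 : ϖ * z ∈ nonunits 𝔬 := fun h' => hϖ.not_isUnit (isUnit_of_mul_isUnit_left h')
  have := nonunits_add (show u + ϖ * z ∈ nonunits 𝔬 from h)
    (show -(ϖ * z) ∈ nonunits 𝔬 by simpa using h1)
  rw [add_neg_cancel_right] at this
  exact this hu

/-- The difference of `u ϖ ^ m` and `v ϖ ^ b` for units `u`, `v` and `m ≠ b`. -/
theorem exists_unit_sub [IsLocalRing 𝔬] (hϖ : Irreducible ϖ) {u v : 𝔬} (hu : IsUnit u) (hv : IsUnit v) {m b : ℕ}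
    (h : m ≠ b) : ∃ y, IsUnit y ∧ v * ϖ ^ b - u * ϖ ^ m = y * ϖ ^ min m b := by
  rcases lt_or_gt_of_ne h with h | h
  · obtain ⟨k, rfl⟩ := Nat.exists_eq_add_of_lt h
    refine ⟨-u + ϖ * (v * ϖ ^ k), isUnit_add_mul_of_irreducible hϖ hu.neg _, ?_⟩
    rw [min_eq_left h.le, pow_succ, pow_add]
    ring
  · obtain ⟨k, rfl⟩ := Nat.exists_eq_add_of_lt h
    refine ⟨v + ϖ * (-u * ϖ ^ k), isUnit_add_mul_of_irreducible hϖ hv _, ?_⟩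
    rw [min_eq_right h.le, pow_succ, pow_add]
    ring

variable (Ψ : AddChar 𝔬 ℂˣ)

/-- Every exclusion below ends here: an argument congruent to `ϖ^(r-1)` contradicts the commutator
condition. -/
theorem addChar_ne_one {r : ℕ} (h0 : ∀ z, ϖ ^ r ∣ z → Ψ z = 1) (h1 : Ψ (ϖ ^ (r - 1)) ≠ 1)
    {z : 𝔬} (hz : ϖ ^ r ∣ z - ϖ ^ (r - 1)) : Ψ z ≠ 1 := by
  have := Ψ.map_add_eq_mul (z - ϖ ^ (r - 1)) (ϖ ^ (r - 1))
  rw [sub_add_cancel, h0 _ hz, one_mul] at this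
  rwa [this]

/-- The condition on `x` coming from the commutators of `unip a x` with elements congruent to
`s + t A`, in terms of a character `Ψ` of `𝔬`. -/
def CommCondition (ϖ : 𝔬) (l : ℕ) (α β x : 𝔬) : Prop :=
  ∀ s t, ϖ ^ l ∣ compNorm α β s t - 1 → ϖ ^ l ∣ t * x →
    Ψ (x * (compNorm α β s t - 1) - s * t * x ^ 2) = 1

variable {Ψ}

/-- For the scalar `s = 1 + c ϖ^i`, the norm minus one is `2 c ϖ^i + c² ϖ^(2i)`. The linear term
detects `x`, and `r ≥ 4 e` makes the quadratic one negligible. -/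
theorem CommCondition.le_of_two_eq {r e m : ℕ} (h0 : ∀ z, ϖ ^ r ∣ z → Ψ z = 1)
    (h1 : Ψ (ϖ ^ (r - 1)) ≠ 1) (he : 1 ≤ e) (hr : 4 * e ≤ r) {α β ε u : 𝔬}
    (hε : IsUnit ε) (h2 : (2 : 𝔬) = ε * ϖ ^ e) (hu : IsUnit u)
    (hx : CommCondition Ψ ϖ (ell r) α β (u * ϖ ^ m)) : ell r ≤ m + 1 := by
  by_contra! hm
  unfold ell at *
  obtain ⟨c, hc⟩ := (hu.mul hε).exists_right_inv
  -- This `i` gives `2 x ϖ^i` valuation `r - 1`; the factor `c` normalizes its unit to 1.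
  obtain ⟨i, hi⟩ : ∃ i, i + m + e + 1 = r := ⟨r - 1 - m - e, by omega⟩
  have hN : compNorm α β (1 + c * ϖ ^ i) 0 - 1 = ε * ϖ ^ (e + i) * c + c ^ 2 * ϖ ^ (2 * i) := by
    rw [compNorm, pow_add, mul_comm 2 i, pow_mul]
    linear_combination c * ϖ ^ i * h2
  refine addChar_ne_one Ψ h0 h1 ?_ (hx (1 + c * ϖ ^ i) 0 ?_ (by simp))
  · obtain ⟨k, hk⟩ : ∃ k, m + 2 * i = r + k := ⟨m + 2 * i - r, by omega⟩
    refine ⟨u * c ^ 2 * ϖ ^ k, ?_⟩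
    have e1 : ϖ ^ m * ϖ ^ (2 * i) = ϖ ^ r * ϖ ^ k := by rw [← pow_add, ← pow_add, hk]
    have e2 : ϖ ^ m * ϖ ^ (e + i) = ϖ ^ (r - 1) := by
      rw [← pow_add]; congr 1; omega
    rw [hN]
    linear_combination u * c ^ 2 * e1 + u * ε * c * e2 + ϖ ^ (r - 1) * hc
  · rw [hN]
    exact dvd_add (((pow_dvd_pow _ (by omega)).mul_left _).mul_right _)
      ((pow_dvd_pow _ (by omega)).mul_left _)

/-- Squaring is additive in characteristic two and surjective on the residue field, so the error at
`ϖ^k` is absorbed into `γ` for even `k` and into `δ` for odd `k`. -/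
theorem exists_sq_add_mul_sq (h2 : (2 : 𝔬) = 0) (hsq : ∀ c : 𝔬, ∃ y, ϖ ∣ c - y ^ 2) (a : 𝔬) (k : ℕ) :
    ∃ γ δ, ϖ ^ k ∣ a - (γ ^ 2 + ϖ * δ ^ 2) := by
  induction k with
  | zero => exact ⟨0, 0, by simp⟩
  | succ k ih =>
    obtain ⟨γ, δ, c, hc⟩ := ih
    obtain ⟨y, z, hz⟩ := hsq c
    rcases Nat.even_or_odd' k with ⟨i, rfl | rfl⟩
    · refine ⟨γ + ϖ ^ i * y, δ, z, ?_⟩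
      rw [pow_succ]
      rw [mul_comm 2 i, pow_mul] at *
      linear_combination hc + (ϖ ^ i) ^ 2 * hz - γ * ϖ ^ i * y * h2
    · refine ⟨γ, δ + ϖ ^ i * y, z, ?_⟩
      rw [pow_succ _ (2 * i + 1)]
      rw [pow_succ _ (2 * i), mul_comm 2 i, pow_mul] at *
      linear_combination hc + (ϖ ^ i) ^ 2 * ϖ * hz - ϖ * δ * ϖ ^ i * y * h2

theorem exists_sq_mul_sub_one (hsq : ∀ c : 𝔬, ∃ y, ϖ ∣ c - y ^ 2) {u : 𝔬} (hu : IsUnit u) :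
    ∃ y, ϖ ∣ u * y ^ 2 - 1 := by
  obtain ⟨c, hc⟩ := hu.exists_right_inv
  obtain ⟨y, z, hz⟩ := hsq c
  exact ⟨y, -(u * z), by linear_combination hc - u * hz⟩

/-- In characteristic two the scalar `1 + y ϖ^j` has norm `1 + y² ϖ^(2j)`, so `x (N - 1)` can be
given valuation `r - 1` as soon as `r - 1 - m` is even. -/
theorem CommCondition.mod_two_eq {r m : ℕ} (h2 : (2 : 𝔬) = 0)
    (hsq : ∀ c : 𝔬, ∃ y, ϖ ∣ c - y ^ 2) (h0 : ∀ z, ϖ ^ r ∣ z → Ψ z = 1)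
    (h1 : Ψ (ϖ ^ (r - 1)) ≠ 1) {α β u : 𝔬} (hu : IsUnit u)
    (hx : CommCondition Ψ ϖ (ell r) α β (u * ϖ ^ m)) (hm : m < ell' r) : m % 2 = r % 2 := by
  by_contra hmr
  unfold ell ell' at *
  obtain ⟨j, hj⟩ : ∃ j, m + 2 * j + 1 = r := ⟨(r - 1 - m) / 2, by omega⟩
  obtain ⟨y, z, hz⟩ := exists_sq_mul_sub_one hsq hu
  have hN : compNorm α β (1 + y * ϖ ^ j) 0 - 1 = y ^ 2 * ϖ ^ (2 * j) := by
    rw [compNorm, mul_comm 2 j, pow_mul]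
    linear_combination y * ϖ ^ j * h2
  refine addChar_ne_one Ψ h0 h1 ?_ (hx (1 + y * ϖ ^ j) 0 ?_ (by simp))
  · refine ⟨z, ?_⟩
    have e1 : ϖ ^ m * ϖ ^ (2 * j) = ϖ ^ (r - 1) := by
      rw [← pow_add]; congr 1; omega
    have e2 : ϖ ^ r = ϖ ^ (r - 1) * ϖ := by rw [← pow_succ]; congr 1; omega
    rw [hN, e2]
    linear_combination u * y ^ 2 * e1 + ϖ ^ (r - 1) * hz
  · rw [hN]
    exact (pow_dvd_pow _ (by omega)).mul_left _

/-- Of the two terms in `key`, one has valuation linear in `j` with slope 1, the other slope 2.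
Unless the stated equality holds, some `j` puts one exactly at `r - 1` and the other at `r` or
beyond. -/
theorem CommCondition.add_min_eq [IsLocalRing 𝔬] {r m b d : ℕ} (hϖ : Irreducible ϖ) (h2 : (2 : 𝔬) = 0)
    (hsq : ∀ c : 𝔬, ∃ y, ϖ ∣ c - y ^ 2) (h0 : ∀ z, ϖ ^ r ∣ z → Ψ z = 1)
    (h1 : Ψ (ϖ ^ (r - 1)) ≠ 1) {γ δ v u : 𝔬} (hu : IsUnit u) (hv : IsUnit v) (hδ : IsUnit δ)
    (hx : CommCondition Ψ ϖ (ell r) (γ ^ 2 + ϖ * (δ * ϖ ^ d) ^ 2) (v * ϖ ^ b) (u * ϖ ^ m))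
    (hm : m < ell' r) (hmb : m ≠ b) : m + 2 * min m b = r + 2 * d := by
  have hpar := hx.mod_two_eq h2 hsq h0 h1 hu hm
  obtain ⟨y, hy, hsub⟩ := exists_unit_sub hϖ hu hv hmb
  have key : ∀ (c : 𝔬) (j : ℕ), ell r ≤ j + m → ell r ≤ j + b → ell r ≤ 1 + 2 * d + 2 * j →
      Ψ (-(u * δ ^ 2 * c ^ 2) * ϖ ^ (m + 1 + 2 * d + 2 * j) +
        (1 + γ * c * ϖ ^ j) * c * u * y * ϖ ^ (j + m + min m b)) = 1 := by
    intro c j hjm hjb hjd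
    -- With `s = 1 + γ t`, the square `γ² t²` in `s²` cancels the one in `α t²`, and the cross term
    -- `2 γ t` is zero.
    have hN : compNorm (γ ^ 2 + ϖ * (δ * ϖ ^ d) ^ 2) (v * ϖ ^ b) (1 + γ * (c * ϖ ^ j))
        (c * ϖ ^ j) - 1 = (1 + γ * (c * ϖ ^ j)) * c * v * ϖ ^ (j + b) -
          δ ^ 2 * c ^ 2 * ϖ ^ (1 + 2 * d + 2 * j) := by
      rw [compNorm]
      simp only [pow_add, mul_comm 2, pow_mul]
      linear_combination γ * c * ϖ ^ j * h2
    have := hx (1 + γ * (c * ϖ ^ j)) (c * ϖ ^ j) ?_ ?_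
    · rw [hN] at this
      rw [← this]
      congr 1
      simp only [pow_add, mul_comm 2, pow_mul]
      linear_combination -((1 + γ * c * ϖ ^ j) * c * u * ϖ ^ j * ϖ ^ m) * hsub
    · rw [hN]
      exact dvd_sub ((pow_dvd_pow _ hjb).mul_left _) ((pow_dvd_pow _ hjd).mul_left _)
    · rw [show c * ϖ ^ j * (u * ϖ ^ m) = c * u * ϖ ^ (j + m) by ring]
      exact (pow_dvd_pow _ hjm).mul_left _
  unfold ell ell' at *
  by_contra hne
  have e2 : ϖ ^ r = ϖ ^ (r - 1) * ϖ := by rw [← pow_succ]; congr 1; omega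
  rcases lt_or_gt_of_ne hne with hlt | hlt
  · obtain ⟨j, hj⟩ : ∃ j, j + m + min m b + 1 = r := ⟨r - 1 - (m + min m b), by omega⟩
    obtain ⟨k, hk⟩ : ∃ k, m + 1 + 2 * d + 2 * j = r + k :=
      ⟨m + 1 + 2 * d + 2 * j - r, by omega⟩
    -- Positivity of `j`, a consequence of `m < ℓ'`, makes `1 + γ c ϖ^j` congruent to 1 mod `ϖ`.
    obtain ⟨i, rfl⟩ : ∃ i, j = i + 1 := ⟨j - 1, by omega⟩
    obtain ⟨c, hc⟩ := (hu.mul hy).exists_right_inv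
    refine addChar_ne_one Ψ h0 h1 ?_ (key c (i + 1) (by omega) (by omega) (by omega))
    rw [hk, show i + 1 + m + min m b = r - 1 by omega]
    refine ⟨-(u * δ ^ 2 * c ^ 2) * ϖ ^ k + γ * c * ϖ ^ i * c * u * y, ?_⟩
    rw [pow_add, e2]
    linear_combination ϖ ^ (r - 1) * hc
  -- The parity `hpar` makes this division exact; it also turns the strict inequality into a gap of
  -- two, which pushes the other term to `ϖ^r`.
  · obtain ⟨j, hj⟩ : ∃ j, m + 1 + 2 * d + 2 * j + 1 = r := ⟨(r - 2 - m) / 2 - d, by omega⟩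
    obtain ⟨k, hk⟩ : ∃ k, j + m + min m b = r + k := ⟨j + m + min m b - r, by omega⟩
    obtain ⟨c, z, hc⟩ := exists_sq_mul_sub_one hsq (hu.mul (hδ.pow 2)).neg
    refine addChar_ne_one Ψ h0 h1 ?_ (key c j (by omega) (by omega) (by omega))
    rw [hk, show m + 1 + 2 * d + 2 * j = r - 1 by omega]
    refine ⟨z + (1 + γ * c * ϖ ^ j) * c * u * y * ϖ ^ k, ?_⟩
    rw [pow_add, e2]
    linear_combination ϖ ^ (r - 1) * hc

end Valuations

/-! ### Counting by leading coefficients -/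

section Counting

variable {𝔬 : Type*} [CommRing 𝔬] [IsLocalRing 𝔬]

/-- An additive subgroup `T` of `𝔬_l` such that the valuations of its nonzero elements lie in `V`
has at most `q ^ |V|` elements. -/
theorem card_le_pow_card_valuations [Finite (ResidueField 𝔬)] {ϖ : 𝔬}
    (hmax : maximalIdeal 𝔬 = Ideal.span {ϖ}) {l : ℕ} [Finite (Quo 𝔬 l)] (T : AddSubgroup (Quo 𝔬 l))
    (V : Finset ℕ)
    (hV : ∀ m < l, ∀ u : 𝔬, IsUnit u → (Ideal.Quotient.mk _ (u * ϖ ^ m) : Quo 𝔬 l) ∈ T → m ∈ V) :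
    Nat.card T ≤ Nat.card (ResidueField 𝔬) ^ V.card := by
  have hq : 1 ≤ Nat.card (ResidueField 𝔬) := Nat.card_pos
  let p : Quo 𝔬 l := Ideal.Quotient.mk _ ϖ
  let F : ℕ → AddSubgroup (Quo 𝔬 l) := fun i => T ⊓ (Ideal.span {p ^ i}).toAddSubgroup
  have hF : ∀ i x, x ∈ F i ↔ x ∈ T ∧ ∃ c : 𝔬, x = Ideal.Quotient.mk _ (c * ϖ ^ i) := by
    intro i x
    refine and_congr Iff.rfl (Ideal.mem_span_singleton'.trans ⟨?_, ?_⟩)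
    · rintro ⟨c, hc⟩
      obtain ⟨c, rfl⟩ := Ideal.Quotient.mk_surjective c
      exact ⟨c, by rw [map_mul, map_pow, ← hc]⟩
    · rintro ⟨c, hc⟩
      exact ⟨Ideal.Quotient.mk _ c, by rw [hc, map_mul, map_pow]⟩
  have hmem : ∀ c : 𝔬, residue 𝔬 c = 0 → ∃ z, c = z * ϖ := by
    intro c hc
    rw [residue_eq_zero_iff, hmax, Ideal.mem_span_singleton'] at hc
    exact hc.imp fun _ h => h.symm
  -- Descending induction on `i`: the step from `F (i + 1)` to `F i` costs a factor `q` only if `i ∈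
  -- V`.
  have main : ∀ k i, i + k = l →
      Nat.card (F i) ≤ Nat.card (ResidueField 𝔬) ^ (V.filter (i ≤ ·)).card := by
    intro k
    induction k with
    | zero =>
      rintro i rfl
      have : F (i + 0) = ⊥ := by
        rw [eq_bot_iff]
        intro x hx
        obtain ⟨-, c, rfl⟩ := (hF _ x).1 hx
        rw [AddSubgroup.mem_bot, Ideal.Quotient.eq_zero_iff_mem, hmax, Ideal.span_singleton_pow]
        exact Ideal.mul_mem_left _ _ (Ideal.mem_span_singleton_self _)
      change Nat.card (F (i + 0)) ≤ _
      rw [this, AddSubgroup.card_bot]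
      exact Nat.one_le_pow _ _ hq
    | succ k ih =>
      intro i hi
      have ih := ih (i + 1) (by omega)
      by_cases hiV : i ∈ V
      · have hfilter : V.filter (i ≤ ·) = insert i (V.filter (i + 1 ≤ ·)) := by
          ext j
          simp only [Finset.mem_filter, Finset.mem_insert]
          constructor
          · rintro ⟨h1, h2⟩
            rcases eq_or_lt_of_le h2 with h | h
            · exact Or.inl h.symm
            · exact Or.inr ⟨h1, h⟩
          · rintro (rfl | ⟨h1, h2⟩)
            · exact ⟨hiV, le_rfl⟩
            · exact ⟨h1, by omega⟩
        rw [hfilter, Finset.card_insert_of_notMem (by simp), pow_succ']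
        refine le_trans ?_ (Nat.mul_le_mul_left _ ih)
        choose c hc using fun x : F i => ((hF i x).1 x.2).2
        let f : F i → ResidueField 𝔬 := fun x => residue 𝔬 (c x)
        have hsub : ∀ x y : F i, f x = f y → (x : Quo 𝔬 l) - y ∈ F (i + 1) := by
          intro x y hxy
          obtain ⟨z, hz⟩ := hmem (c x - c y) (by rw [map_sub]; exact sub_eq_zero.2 hxy)
          refine (hF _ _).2 ⟨T.sub_mem ((hF i x).1 x.2).1 ((hF i y).1 y.2).1, z, ?_⟩
          rw [hc x, hc y, ← map_sub]
          congr 1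
          rw [pow_succ]
          linear_combination ϖ ^ i * hz
        -- `Function.invFun f` picks one element per leading coefficient; an element of `F i` is
        -- determined by its coefficient and its difference from that representative.
        have hinv : ∀ x, f (Function.invFun f (f x)) = f x := fun x => Function.invFun_eq ⟨x, rfl⟩
        rw [← Nat.card_prod]
        refine Nat.card_le_card_of_injective
          (fun x => (f x, (⟨_, hsub x _ (hinv x).symm⟩ : F (i + 1)))) ?_
        intro x y hxy
        simp only [Prod.mk.injEq, Subtype.mk.injEq] at hxy
        rw [hxy.1] at hxy
        exact Subtype.ext (sub_left_injective hxy.2)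
      · have hle : F i ≤ F (i + 1) := by
          intro x hx
          obtain ⟨hT, c, rfl⟩ := (hF _ x).1 hx
          by_cases hc : IsUnit c
          · exact absurd (hV i (by omega) c hc hT) hiV
          · obtain ⟨z, rfl⟩ := hmem c (by
              rw [residue_eq_zero_iff]
              exact (mem_maximalIdeal c).2 hc)
            exact (hF _ _).2 ⟨hT, z, by rw [mul_assoc, ← pow_succ']⟩
        refine (Nat.card_le_card_of_injective _ (AddSubgroup.inclusion_injective hle)).trans
          (ih.trans (Nat.pow_le_pow_right hq (Finset.card_le_card ?_)))
        intro j
        simp only [Finset.mem_filter]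
        exact fun h => ⟨h.1, by omega⟩
  have h0 := main l 0 (by omega)
  have hF0 : F 0 = T := by simp [F]
  rw [hF0] at h0
  simpa using h0

/-- The group of all `x` such that `conjUnip N x` stabilizes `χ`. -/
def stabAdd {r : ℕ} [Finite (Quo 𝔬 r)] {At : Matrix (Fin 2) (Fin 2) (Quo 𝔬 r)}
    (N : NormalForm At) (χ : cS At →* ℂˣ) : AddSubgroup (Quo 𝔬 r) :=
  let M : AddSubmonoid (Quo 𝔬 r) :=
    { carrier := {x | ∀ X : cS At, ∃ hX : conjUnip N x * X * (conjUnip N x)⁻¹ ∈ cS At,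
        χ ⟨conjUnip N x * X * (conjUnip N x)⁻¹, hX⟩ = χ X}
      zero_mem' := by
        have h : conjUnip N (0 : Quo 𝔬 r) = 1 := by simp [conjUnip, unip_zero]
        intro X
        simp [h]
      add_mem' := by
        intro x y hx hy X
        have h : conjUnip N (x + y) = conjUnip N x * conjUnip N y := by
          rw [conjUnip, unip_add, conjUnip, conjUnip]
          group
        obtain ⟨h1, h2⟩ := hy X
        obtain ⟨h3, h4⟩ := hx ⟨_, h1⟩
        have e : conjUnip N (x + y) * X * (conjUnip N (x + y))⁻¹ =
            conjUnip N x * (conjUnip N y * X * (conjUnip N y)⁻¹) * (conjUnip N x)⁻¹ := by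
          rw [h]
          group
        simp only [e]
        exact ⟨h3, h4.trans h2⟩ }
  { M with
    neg_mem' := by
      intro x hx
      -- By finiteness `-x` is a natural multiple of `x`, so closure under addition suffices.
      have h : -x ∈ AddSubmonoid.multiples x :=
        (isOfFinAddOrder_of_finite x).mem_multiples_iff_mem_zmultiples.2
          (neg_mem (AddSubgroup.mem_zmultiples x))
      exact (AddSubmonoid.multiples_le.2 (show x ∈ M from hx)) h }

theorem conjUnip_mem_cS {r : ℕ} {At : Matrix (Fin 2) (Fin 2) (Quo 𝔬 r)}
    (N : NormalForm At) {x : Quo 𝔬 r} (hx : red 𝔬 (ell_le r) x = 0) : conjUnip N x ∈ cS At := by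
  refine congSL_le_cS At ?_
  have h : unip N.a x ∈ congSL (𝔬 := 𝔬) (ell_le r) := by
    change SpecialLinearGroup.map (n := Fin 2) (red 𝔬 (ell_le r)) _ = 1
    ext i j
    change red 𝔬 (ell_le r)
      ((!![1, ((N.a⁻¹ : (Quo 𝔬 r)ˣ) : Quo 𝔬 r) * x; 0, 1] : Matrix (Fin 2) (Fin 2) (Quo 𝔬 r)) i j) =
      (1 : Matrix (Fin 2) (Fin 2) (Quo 𝔬 (ell r))) i j
    fin_cases i <;> fin_cases j <;> simp [hx]
  have := (MonoidHom.normal_ker _ : (congSL (𝔬 := 𝔬) (ell_le r)).Normal).conj_mem _ h N.g⁻¹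
  rwa [inv_inv] at this

/-- For each residue fix a stabilizing lift. Changing `x` within its residue class alters the
unipotent by an element of `K^ℓ`, which is absorbed into the factor from `C_S^ℓ`. -/
theorem card_stab_le {r : ℕ} [Finite (Quo 𝔬 r)] {At : Matrix (Fin 2) (Fin 2) (Quo 𝔬 r)}
    (N : NormalForm At) (χ : cS At →* ℂˣ) :
    Nat.card (stab N χ) ≤
      Nat.card (cS At) * Nat.card ((stabAdd N χ).map (red 𝔬 (ell_le r)).toAddMonoidHom) := by
  have : Finite ((stabAdd N χ).map (red 𝔬 (ell_le r)).toAddMonoidHom) :=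
    (Set.toFinite ((red 𝔬 (ell_le r)) '' (stabAdd N χ : Set (Quo 𝔬 r)))).to_subtype
  rw [← Nat.card_prod]
  choose lift hlift hred using fun y : (stabAdd N χ).map (red 𝔬 (ell_le r)).toAddMonoidHom =>
    AddSubgroup.mem_map.1 y.2
  let f : cS At × (stabAdd N χ).map (red 𝔬 (ell_le r)).toAddMonoidHom →
      SpecialLinearGroup (Fin 2) (Quo 𝔬 r) := fun z => z.1 * conjUnip N (lift z.2)
  have hsub : stab N χ ⊆ Set.range f := by
    rintro g ⟨⟨c, hc, h, ⟨x, -, rfl⟩, rfl⟩, hg⟩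
    change ∀ X : cS At, ∃ hX : c * conjUnip N x * X * (c * conjUnip N x)⁻¹ ∈ cS At, _ at hg
    have hx : x ∈ stabAdd N χ := by
      intro X
      obtain ⟨h1, h2⟩ := hg X
      have e : conjUnip N x * X * (conjUnip N x)⁻¹ =
          c⁻¹ * (c * conjUnip N x * X * (c * conjUnip N x)⁻¹) * c := by group
      have hX : conjUnip N x * X * (conjUnip N x)⁻¹ ∈ cS At := by
        rw [e]
        exact mul_mem (mul_mem (inv_mem hc) h1) hc
      refine ⟨hX, ?_⟩
      have e' : (⟨_, hX⟩ : cS At) = (⟨c, hc⟩ : cS At)⁻¹ * ⟨_, h1⟩ * ⟨c, hc⟩ := Subtype.ext e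
      rw [e', map_mul, map_mul, map_inv, mul_right_comm, inv_mul_cancel, one_mul]
      exact h2
    let y : (stabAdd N χ).map (red 𝔬 (ell_le r)).toAddMonoidHom :=
      ⟨_, AddSubgroup.mem_map_of_mem _ hx⟩
    have hy : red 𝔬 (ell_le r) (x - lift y) = 0 := by
      rw [map_sub, sub_eq_zero]
      exact (hred y).symm
    refine ⟨(⟨c * conjUnip N (x - lift y), mul_mem hc (conjUnip_mem_cS N hy)⟩, y), ?_⟩
    change c * conjUnip N (x - lift y) * conjUnip N (lift y) = c * (conjUnip N x)
    have e := unip_add N.a (x - lift y) (lift y)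
    rw [sub_add_cancel] at e
    rw [conjUnip, conjUnip, conjUnip, e]
    group
  calc Nat.card (stab N χ) ≤ Nat.card (Set.range f) :=
        Nat.card_mono (Set.toFinite _) hsub
    _ ≤ _ := Finite.card_range_le f

end Counting

/-! ### Passage to `𝔬` and arithmetic of the residue field -/

section Main

variable {𝔬 : Type*} [CommRing 𝔬] [IsLocalRing 𝔬]

theorem commCondition_of_mem_stabAdd {ϖ : 𝔬} (hmax : maximalIdeal 𝔬 = Ideal.span {ϖ})
    {r : ℕ} [Finite (Quo 𝔬 r)] {ψ : AddChar (Quo 𝔬 r) ℂˣ}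
    {A : Matrix (Fin 2) (Fin 2) (Quo 𝔬 (ell' r))} {At : Matrix (Fin 2) (Fin 2) (Quo 𝔬 r)}
    (hAt : At.map (red 𝔬 (ell'_le r)) = A) (N : NormalForm At)
    {χ : cS At →* ℂˣ} (hχ : χ ∈ extensions ψ A At) {α β x : 𝔬}
    (hα : Ideal.Quotient.mk _ α = N.α) (hβ : Ideal.Quotient.mk _ β = N.β)
    (hx : Ideal.Quotient.mk _ x ∈ stabAdd N χ) :
    CommCondition (ψ.compAddMonoidHom (Ideal.Quotient.mk _).toAddMonoidHom) ϖ (ell r) α β x := by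
  intro s t h1 h0
  have hred : ∀ y : 𝔬, ϖ ^ ell r ∣ y → red 𝔬 (ell_le r) (Ideal.Quotient.mk _ y) = 0 := by
    intro y hy
    rw [red_eq_zero_iff, hmax, Ideal.span_singleton_pow]
    exact Ideal.mem_span_singleton.2 hy
  have hr : r ≤ ell r + ell r := by unfold ell; omega
  have hN : (Ideal.Quotient.mk _ (compNorm α β s t) : Quo 𝔬 r) =
      compNorm N.α N.β (Ideal.Quotient.mk _ s) (Ideal.Quotient.mk _ t) := by
    rw [← hα, ← hβ]
    simp [compNorm]
  have h1 := hred _ h1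
  rw [map_sub, hN, map_one] at h1
  have h0 := hred _ h0
  rw [map_mul] at h0
  have h11 := mul_eq_zero_of_red _ _ hr h1 h1
  have := apply_eq_one_of_stabilizes hAt N hχ hx
    (n := 2 - compNorm N.α N.β (Ideal.Quotient.mk _ s) (Ideal.Quotient.mk _ t))
    (by linear_combination -h11) h0 (by rwa [map_sub, map_one, sub_eq_zero] at h1)
  rw [← hN] at this
  rw [← this]
  change ψ (Ideal.Quotient.mk _ _) = _
  simp

/-- Working modulo `ϖ^r` gives zero a valuation too: it is replaced by `ϖ^r`. -/
theorem exists_isUnit_mul_pow {R : Type*} [CommRing R] [IsDomain R] [IsDiscreteValuationRing R]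
    {ϖ : R} (hϖ : Irreducible ϖ) (r : ℕ) (y : R) :
    ∃ u n, IsUnit u ∧ ϖ ^ r ∣ y - u * ϖ ^ n := by
  by_cases hy : y = 0
  · exact ⟨1, r, isUnit_one, by simp [hy]⟩
  · obtain ⟨n, u, h⟩ := IsDiscreteValuationRing.associated_pow_irreducible hy hϖ
    refine ⟨(u⁻¹ : Rˣ), n, Units.isUnit _, ?_⟩
    rw [← h, mul_comm, mul_assoc, Units.mul_inv, mul_one, sub_self]
    exact dvd_zero _

theorem exists_dvd_sub_sq [Finite (ResidueField 𝔬)] [CharP (ResidueField 𝔬) 2] {ϖ : 𝔬}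
    (hmax : maximalIdeal 𝔬 = Ideal.span {ϖ}) (c : 𝔬) : ∃ y, ϖ ∣ c - y ^ 2 := by
  obtain ⟨y, hy⟩ := FiniteField.isSquare_of_char_two (ringChar.eq _ 2) (residue 𝔬 c)
  obtain ⟨y, rfl⟩ := residue_surjective y
  refine ⟨y, ?_⟩
  rw [← Ideal.mem_span_singleton, ← hmax, ← residue_eq_zero_iff, map_sub, map_pow, hy, sq, sub_self]

theorem two_eq_zero_of_ringChar_ne_zero [IsDomain 𝔬] [CharP (ResidueField 𝔬) 2]
    (h : ringChar 𝔬 ≠ 0) : (2 : 𝔬) = 0 := by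
  have hp : (ringChar 𝔬).Prime := (CharP.char_is_prime_or_zero 𝔬 (ringChar 𝔬)).resolve_right h
  have h1 : ((ringChar 𝔬 : ℕ) : ResidueField 𝔬) = 0 := by
    rw [← map_natCast (residue 𝔬), CharP.cast_eq_zero, map_zero]
  have h2 := (Nat.prime_dvd_prime_iff_eq Nat.prime_two hp).1
    ((CharP.cast_eq_zero_iff (ResidueField 𝔬) 2 _).1 h1)
  have := CharP.cast_eq_zero 𝔬 (ringChar 𝔬)
  rw [← h2] at this
  exact_mod_cast this

/-- The equation `m + 2 min m b = c` has at most one solution `m`. -/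
theorem card_filter_add_min_le_one (l b c : ℕ) :
    ((Finset.range l).filter fun m => m + 2 * min m b = c).card ≤ 1 := by
  rw [Finset.card_le_one]
  intro m hm n hn
  have h1 := (Finset.mem_filter.1 hm).2
  have h2 := (Finset.mem_filter.1 hn).2
  omega

end Main

/-! ### At most three valuations, and the bound -/

section DiscreteValuationRing

variable {𝔬 : Type*} [CommRing 𝔬] [IsDomain 𝔬] [IsDiscreteValuationRing 𝔬]

theorem two_eq_unit_mul_pow_ramIndex [CharP (ResidueField 𝔬) 2] {ϖ : 𝔬} (hϖ : Irreducible ϖ)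
    (hmax : maximalIdeal 𝔬 = Ideal.span {ϖ}) (h : ringChar 𝔬 = 0) :
    1 ≤ ramIndex 𝔬 ∧ ∃ ε : 𝔬, IsUnit ε ∧ (2 : 𝔬) = ε * ϖ ^ ramIndex 𝔬 := by
  have h2 : (2 : 𝔬) ≠ 0 := by
    intro h2
    have := ringChar.dvd (R := 𝔬) (x := 2) (by exact_mod_cast h2)
    rw [h] at this
    omega
  have hne : {e : ℕ | Ideal.span {(2 : 𝔬)} = maximalIdeal 𝔬 ^ e}.Nonempty := by
    obtain ⟨n, hn⟩ := IsDiscreteValuationRing.associated_pow_irreducible h2 hϖ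
    exact ⟨n, by
      change Ideal.span {(2 : 𝔬)} = maximalIdeal 𝔬 ^ n
      rw [hmax, Ideal.span_singleton_pow, Ideal.span_singleton_eq_span_singleton]
      exact hn⟩
  have he : Ideal.span {(2 : 𝔬)} = maximalIdeal 𝔬 ^ ramIndex 𝔬 := Nat.sInf_mem hne
  rw [hmax, Ideal.span_singleton_pow, Ideal.span_singleton_eq_span_singleton] at he
  obtain ⟨u, hu⟩ := he.symm
  refine ⟨?_, u, u.isUnit, by rw [← hu, mul_comm]⟩
  by_contra! h0
  have h0 : ramIndex 𝔬 = 0 := by omega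
  rw [h0, pow_zero, one_mul] at hu
  have h3 : residue 𝔬 2 = 0 := by
    rw [map_ofNat]
    exact_mod_cast CharP.cast_eq_zero (ResidueField 𝔬) 2
  rw [residue_eq_zero_iff, ← hu] at h3
  exact (mem_maximalIdeal _).1 h3 u.isUnit

/-- The valuations below `ℓ` of elements of `stabAdd N χ` take at most three values. -/
theorem exists_valuations [Finite (ResidueField 𝔬)] [CharP (ResidueField 𝔬) 2]
    {ϖ : 𝔬} (hϖ : Irreducible ϖ) {r : ℕ} (hr : levelBound 𝔬 ≤ r)
    [Finite (Quo 𝔬 r)] {ψ : AddChar (Quo 𝔬 r) ℂˣ}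
    (hψ : ψ (Ideal.Quotient.mk _ (ϖ ^ (r - 1))) ≠ 1)
    {A : Matrix (Fin 2) (Fin 2) (Quo 𝔬 (ell' r))} {At : Matrix (Fin 2) (Fin 2) (Quo 𝔬 r)}
    (hAt : At.map (red 𝔬 (ell'_le r)) = A) (N : NormalForm At)
    {χ : cS At →* ℂˣ} (hχ : χ ∈ extensions ψ A At) :
    ∃ V : Finset ℕ, V.card ≤ 3 ∧ ∀ m < ell r, ∀ u : 𝔬, IsUnit u →
      (Ideal.Quotient.mk _ (u * ϖ ^ m) : Quo 𝔬 r) ∈ stabAdd N χ → m ∈ V := by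
  have hmax : maximalIdeal 𝔬 = Ideal.span {ϖ} := hϖ.maximalIdeal_eq
  have hmk : ∀ y z : 𝔬, ϖ ^ r ∣ y - z →
      (Ideal.Quotient.mk _ z : Quo 𝔬 r) = Ideal.Quotient.mk _ y := by
    intro y z h
    refine (Ideal.Quotient.eq.2 ?_).symm
    rw [hmax, Ideal.span_singleton_pow]
    exact Ideal.mem_span_singleton.2 h
  have h0 : ∀ z, ϖ ^ r ∣ z →
      ψ.compAddMonoidHom (Ideal.Quotient.mk _).toAddMonoidHom z = 1 := by
    intro z hz
    change ψ (Ideal.Quotient.mk _ z) = 1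
    rw [← hmk z 0 (by rwa [sub_zero]), map_zero, AddChar.map_zero_eq_one]
  have h1 : ψ.compAddMonoidHom (Ideal.Quotient.mk _).toAddMonoidHom (ϖ ^ (r - 1)) ≠ 1 := hψ
  obtain ⟨α, hα⟩ := Ideal.Quotient.mk_surjective N.α
  obtain ⟨β, hβ⟩ := Ideal.Quotient.mk_surjective N.β
  by_cases hc : ringChar 𝔬 = 0
  · obtain ⟨he, ε, hε, h2⟩ := two_eq_unit_mul_pow_ramIndex hϖ hmax hc
    rw [levelBound, if_pos hc] at hr
    refine ⟨{ell r - 1}, by simp, fun m hm u hu hx => ?_⟩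
    have := (commCondition_of_mem_stabAdd hmax hAt N hχ hα hβ hx).le_of_two_eq h0 h1 he hr
      hε h2 hu
    rw [Finset.mem_singleton]
    omega
  · have h2 := two_eq_zero_of_ringChar_ne_zero hc
    have hsq := exists_dvd_sub_sq hmax
    obtain ⟨γ, δ, hγ⟩ := exists_sq_add_mul_sq (ϖ := ϖ) h2 hsq α r
    obtain ⟨δ', d, hδ', hδ⟩ := exists_isUnit_mul_pow hϖ r δ
    obtain ⟨v, b, hv, hb⟩ := exists_isUnit_mul_pow hϖ r β
    refine ⟨insert (ell r - 1) (insert b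
      ((Finset.range (ell r)).filter fun m => m + 2 * min m b = r + 2 * d)), ?_, ?_⟩
    · refine (Finset.card_insert_le _ _).trans (Nat.succ_le_succ ?_)
      exact (Finset.card_insert_le _ _).trans (Nat.succ_le_succ (card_filter_add_min_le_one _ _ _))
    · intro m hm u hu hx
      rw [Finset.mem_insert, Finset.mem_insert, Finset.mem_filter, Finset.mem_range]
      by_cases hml : m < ell' r
      · by_cases hmb : m = b
        · exact Or.inr (Or.inl hmb)
        · refine Or.inr (Or.inr ⟨hm, ?_⟩)
          -- The lifts of `N.α` and `N.β` are free modulo `ϖ^r`, so the normalized forms may be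
          -- used.
          refine (commCondition_of_mem_stabAdd hmax hAt N hχ
            (α := γ ^ 2 + ϖ * (δ' * ϖ ^ d) ^ 2) (β := v * ϖ ^ b) ?_ ?_ hx).add_min_eq
            hϖ h2 hsq h0 h1 hu hv hδ' hml hmb
          · rw [← hα]
            refine hmk _ _ ?_
            have e : α - (γ ^ 2 + ϖ * (δ' * ϖ ^ d) ^ 2) = α - (γ ^ 2 + ϖ * δ ^ 2) +
                (δ - δ' * ϖ ^ d) * (ϖ * (δ + δ' * ϖ ^ d)) := by ring
            rw [e]
            exact dvd_add hγ (hδ.mul_right _)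
          · rw [← hβ]
            exact hmk _ _ hb
      -- Here `ℓ' ≤ m < ℓ`, so `r` is odd and `m = ℓ - 1`.
      · left
        unfold ell ell' at *
        omega

end DiscreteValuationRing

end SLTwo

theorem mainTheorem5 {𝔬 : Type*} [CommRing 𝔬] [IsDomain 𝔬] [IsDiscreteValuationRing 𝔬]
    [IsAdicComplete (IsLocalRing.maximalIdeal 𝔬) 𝔬]
    [Finite (IsLocalRing.ResidueField 𝔬)] [CharP (IsLocalRing.ResidueField 𝔬) 2]
    (r : ℕ) (hr : SLTwo.levelBound 𝔬 ≤ r)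
    (ϖ : 𝔬) (hϖ : Irreducible ϖ)
    (ψ : AddChar (SLTwo.Quo 𝔬 r) ℂˣ)
    (hψ : ψ (Ideal.Quotient.mk _ (ϖ ^ (r - 1))) ≠ 1)
    (A : Matrix (Fin 2) (Fin 2) (SLTwo.Quo 𝔬 (SLTwo.ell' r))) (hA : SLTwo.IsCyclicMat A)
    (At : Matrix (Fin 2) (Fin 2) (SLTwo.Quo 𝔬 r))
    (hAt : At.map (SLTwo.red 𝔬 (SLTwo.ell'_le r)) = A)
    (N : SLTwo.NormalForm At)
    (χ : SLTwo.cS At →* ℂˣ) (hχ : χ ∈ SLTwo.extensions ψ A At) :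
    (Nat.card (SLTwo.stab N χ) : ℝ) / (Nat.card (SLTwo.cS At) : ℝ) ≤
      (Nat.card (IsLocalRing.ResidueField 𝔬) : ℝ) ^ 3 := by
  have hmax : IsLocalRing.maximalIdeal 𝔬 = Ideal.span {ϖ} := hϖ.maximalIdeal_eq
  have hfin : ∀ k, Finite (SLTwo.Quo 𝔬 k) := fun k =>
    have : Finite (𝔬 ⧸ IsLocalRing.maximalIdeal 𝔬) :=
      inferInstanceAs (Finite (IsLocalRing.ResidueField 𝔬))
    Ideal.finite_quotient_pow (IsNoetherian.noetherian _) k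
  have := hfin r
  have := hfin (SLTwo.ell r)
  obtain ⟨V, hV3, hV⟩ := SLTwo.exists_valuations hϖ hr hψ hAt N hχ
  have hcard := SLTwo.card_le_pow_card_valuations hmax
    ((SLTwo.stabAdd N χ).map (SLTwo.red 𝔬 (SLTwo.ell_le r)).toAddMonoidHom) V (by
      intro m hm u hu hx
      obtain ⟨x, hx, hxu⟩ := AddSubgroup.mem_map.1 hx
      obtain ⟨x, rfl⟩ := Ideal.Quotient.mk_surjective x
      have hsub : x - u * ϖ ^ m ∈ IsLocalRing.maximalIdeal 𝔬 ^ SLTwo.ell r :=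
        Ideal.Quotient.eq.1 hxu
      rw [hmax, Ideal.span_singleton_pow, Ideal.mem_span_singleton] at hsub
      obtain ⟨z, hz⟩ := hsub
      obtain ⟨k, hk⟩ := Nat.exists_eq_add_of_lt hm
      -- A lift of `u ϖ^m` from `𝔬_ℓ` differs from it by a multiple of `ϖ^ℓ` with `ℓ > m`; this
      -- changes only the unit.
      refine hV m hm (u + ϖ * (ϖ ^ k * z)) (SLTwo.isUnit_add_mul_of_irreducible hϖ hu _) ?_
      convert hx using 2
      rw [hk, pow_succ, pow_add] at hz
      linear_combination -hz)
  have hq : 1 ≤ Nat.card (IsLocalRing.ResidueField 𝔬) := Nat.card_pos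
  have hle := (SLTwo.card_stab_le N χ).trans
    (Nat.mul_le_mul_left _ (hcard.trans (Nat.pow_le_pow_right hq hV3)))
  have hpos : (0 : ℝ) < Nat.card (SLTwo.cS At) := by exact_mod_cast Nat.card_pos
  rw [div_le_iff₀' hpos]
  exact_mod_cast hle
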